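/- Let $N\ge 1$ be an integer. Consider the generalized Laguerre ensemble with $\gamma_1N=N$, $\gamma_2N=N+1$, that is, $N$ eigenvalues $\lambda_1,\dots,\lambda_N\ge 0$ with joint density proportional to $$\Delta^2(\lambda)\prod_{i=1}^N \lambda_i\,e^{-N\lambda_i},\qquad \Delta(\lambda)=\prod_{i<j}(\lambda_i-\lambda_j)$$ (so that the exponent of each $\lambda_i$ is $(\gamma_2-\gamma_1)N=1$). Let $$W_1(x)=\frac1N\cdot\frac1{\mathcal Z}\int_{[0,\infty)^N}\Delta^2(\lambda)\prod_{i=1}^N\lambda_i e^{-N\lambda_i}\,\sum_{i=1}^N\frac1{x-\lambda_i}\;d\lambda_1\cdots d\lambda_N ,\qquad x\in\mathbb C\setminus[0,\infty),$$ be the one-loop mean, where $\mathcal Z=\int_{[0,\infty)^N}\Delta^2(\lambda)\prod_i\lambda_ie^{-N\lambda_i}\,d\lambda$. Then $0<\mathcal Z<\infty$, the integral defining $W_1(x)$ converges absolutely for every $x\in\mathbb C\setminus[0,\infty)$, the function $W_1$ is holomorphic on $\mathbb C\setminus[0,\infty)$, and there it satisfies the inhomogeneous fourth-order linear differential equation $$\begin{aligned}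 \Bigl[\,&N^2\Bigl((-2x^2+8x)\frac{\partial}{\partial x}+4\Bigr)+N\Bigl((-x^2+8x)\frac{\partial}{\partial x}+4\Bigr)\\ &+\Bigl(2x^2\frac{\partial^3}{\partial x^3}+(-x^2+12x)\frac{\partial^2}{\partial x^2}+(-x+12)\frac{\partial}{\partial x}+1\Bigr)\\ &+N^{-1}\Bigl(x^2\frac{\partial^3}{\partial x^3}+6x\frac{\partial^2}{\partial x^2}+6\frac{\partial}{\partial x}\Bigr) +N^{-2}\Bigl(x^2\frac{\partial^4}{\partial x^4}+7x\frac{\partial^3}{\partial x^3}+9\frac{\partial^2}{\partial x^2}\Bigr)\Bigr]W_1(x) =2N^2+N+\frac{2N+2}{x}. \end{aligned}$$ -/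

import Mathlib

open MeasureTheory

noncomputable section

namespace LaguerreLoop

/-- The Vandermonde product `∏_{i<j} (l i - l j)`. -/
def vandermondeProd {N : ℕ} (l : Fin N → ℝ) : ℝ :=
  ∏ i : Fin N, ∏ j ∈ Finset.Ioi i, (l i - l j)

/-- The unnormalized joint eigenvalue density `Δ(l)² ∏_i l_i ^ k e^{-N l_i}` of the generalized
Laguerre ensemble of `N × N` nonnegative Hermitian matrices with the matrix weight
`(det H) ^ k e^{-N tr H}`. It is used only on the orthant `l ≥ 0`. In terms of rectangular
`N × (N + k)` complex matrices, the exponent is `k = (γ₂ - γ₁) N`, with `γ₁ N = N` and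
`γ₂ N = N + k`. -/
def eigenDensity (k N : ℕ) (l : Fin N → ℝ) : ℝ :=
  vandermondeProd l ^ 2 * ∏ i : Fin N, (l i ^ k * Real.exp (-(N : ℝ) * l i))

/-- The orthant `[0, ∞)^N`. -/
def orthant (N : ℕ) : Set (Fin N → ℝ) := {l | ∀ i, 0 ≤ l i}

/-- The partition function. -/
def partitionFn (k N : ℕ) : ℝ := ∫ l in orthant N, eigenDensity k N l

/-- The density times `tr (x - H)⁻¹ = ∑_i 1 / (x - l_i)`. -/
def resolventIntegrand (k N : ℕ) (x : ℂ) (l : Fin N → ℝ) : ℂ :=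
  (eigenDensity k N l : ℂ) * ∑ i : Fin N, 1 / (x - (l i : ℂ))

/-- The one-loop mean `W₁(x) = ⟨ (1/N) tr (x - H)⁻¹ ⟩`, which behaves as `1 / x` at infinity. -/
def oneLoopMean (k N : ℕ) (x : ℂ) : ℂ :=
  (1 / (N : ℂ)) * ((1 / (partitionFn k N : ℂ)) * ∫ l in orthant N, resolventIntegrand k N x l)

/-- The complex plane without the half-line `[0, ∞)` that carries the eigenvalues. -/
def offCut : Set ℂ := {x | ∀ r : ℝ, 0 ≤ r → x ≠ (r : ℂ)}

end LaguerreLoop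

end

/-! The density is a squared Vandermonde times a product weight. Replacing monomials by the monic
polynomials p_k orthogonal for t e^{-Nt}, with squared norms h_k, reduces averages of ∑ g(λ_i) to
integrals of g against f e^{-Nt}, up to constants, where f = N⁻¹ t ∑_{k<N} p_k²/h_k
(`integral_eigenDensity_mul_sum`). Hence W₁ is the Stieltjes transform of f e^{-Nt}.

By Christoffel–Darboux, f is a quadratic form in u = p_{N-1} and v = p_N. These solve a first-order
linear system, so f e^{-Nt} and all its derivatives lie in e^{-Nt} times the span of u², uv, v² over
the rational functions, which forces linear differential equations. `laguerre_density_ode` checks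
that the operator of the theorem, acting in t, annihilates f e^{-Nt}.

The Stieltjes transform carries d/dt to d/dx and multiplication by t to multiplication by x, up to
boundary values at 0 and moments (`hasDerivAt_stieltjes`, `stieltjes_X_mul`). These corrections form
the right-hand side: the total mass 1 gives 2N² + N, and f'(0) = N²(N+1)/2 gives (2N+2)/x. -/

namespace LaguerreLoop

open Polynomial Filter Topology Set

/-! ### Monic Laguerre polynomials: recurrence, structure relations, Christoffel–Darboux -/

/-- The monic orthogonal polynomials for the weight `t e^{-t/a}` on `[0, ∞)`. -/
noncomputable def monicLaguerre (a : ℝ) : ℕ → ℝ[X]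
  | 0 => 1
  | 1 => X - C (2 * a)
  | k + 2 => (X - C ((2 * k + 4) * a)) * monicLaguerre a (k + 1)
      - C ((k + 1) * (k + 2) * a ^ 2) * monicLaguerre a k

theorem monicLaguerre_zero (a : ℝ) : monicLaguerre a 0 = 1 := by rw [monicLaguerre]

theorem monicLaguerre_one (a : ℝ) : monicLaguerre a 1 = X - C (2 * a) := by rw [monicLaguerre]

theorem monicLaguerre_add_two (a : ℝ) (k : ℕ) :
    monicLaguerre a (k + 2) = (X - C ((2 * k + 4) * a)) * monicLaguerre a (k + 1)
      - C ((k + 1) * (k + 2) * a ^ 2) * monicLaguerre a k := by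
  rw [monicLaguerre]

theorem monicLaguerre_monic_and_natDegree (a : ℝ) (k : ℕ) :
    ((monicLaguerre a k).Monic ∧ (monicLaguerre a k).natDegree = k) ∧
      (monicLaguerre a (k + 1)).Monic ∧ (monicLaguerre a (k + 1)).natDegree = k + 1 := by
  induction k with
  | zero =>
    refine ⟨⟨?_, ?_⟩, ?_, ?_⟩
    · rw [monicLaguerre_zero]; exact monic_one
    · rw [monicLaguerre_zero]; exact natDegree_one
    · rw [monicLaguerre_one]; exact monic_X_sub_C _
    · rw [monicLaguerre_one]; exact natDegree_X_sub_C _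
  | succ k ih =>
    refine ⟨ih.2, ?_⟩
    have hm : ((X - C ((2 * k + 4) * a)) * monicLaguerre a (k + 1)).Monic :=
      (monic_X_sub_C _).mul ih.2.1
    have hd : ((X - C ((2 * k + 4) * a)) * monicLaguerre a (k + 1)).natDegree = k + 2 := by
      rw [(monic_X_sub_C _).natDegree_mul ih.2.1, natDegree_X_sub_C, ih.2.2]; ring
    have hlt : (C ((k + 1) * (k + 2) * a ^ 2) * monicLaguerre a k).degree
        < ((X - C ((2 * k + 4) * a)) * monicLaguerre a (k + 1)).degree := by
      refine degree_lt_degree ((natDegree_C_mul_le _ _).trans_lt ?_)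
      rw [hd, ih.1.2]
      omega
    rw [monicLaguerre_add_two]
    exact ⟨hm.sub_of_left hlt, 
      by rw [natDegree_eq_of_degree_eq (degree_sub_eq_left_of_degree_lt hlt), hd]⟩

/-- Together the two relations make (p_k, p_{k+1}) a closed first-order system. They are proved
jointly because the inductive step for the first uses both. -/
theorem X_mul_derivative_monicLaguerre {n a : ℝ} (h : n * a = 1) (k : ℕ) :
    X * derivative (monicLaguerre a (k + 1)) = ((k : ℝ[X]) + 1) * monicLaguerre a (k + 1)
        + ((k : ℝ[X]) + 1) * ((k : ℝ[X]) + 2) * C a * monicLaguerre a k ∧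
      X * derivative (monicLaguerre a k) = (C n * X - ((k : ℝ[X]) + 2)) * monicLaguerre a k
        - C n * monicLaguerre a (k + 1) := by
  have hC : C n * C a = 1 := by rw [← C_mul, h, C_1]
  induction k with
  | zero =>
    have h2 : C (2 : ℝ) = 2 := rfl
    rw [zero_add, monicLaguerre_zero, monicLaguerre_one, C_mul, h2]
    simp only [derivative_sub, derivative_mul, derivative_X, derivative_C, derivative_one,
      derivative_ofNat, Nat.cast_zero]
    constructor
    · ring
    · linear_combination (-2) * hC
  | succ k ih =>
    obtain ⟨hl, hr⟩ := ih
    have hrec := monicLaguerre_add_two a k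
    simp only [C_mul, C_add, C_pow, map_natCast, map_ofNat, map_one] at hrec
    rw [show k + 1 + 1 = k + 2 from rfl]
    -- Eliminating p_k between the first relation and the recurrence gives the second relation one
    -- index up.
    have hr' : X * derivative (monicLaguerre a (k + 1)) =
        (C n * X - ((k : ℝ[X]) + 3)) * monicLaguerre a (k + 1)
        - C n * monicLaguerre a (k + 2) := by
      linear_combination hl + C n * hrec
        - ((2 * (k : ℝ[X]) + 4) * monicLaguerre a (k + 1)
          + ((k : ℝ[X]) + 1) * ((k : ℝ[X]) + 2) * C a * monicLaguerre a k) * hC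
    refine ⟨?_, by push_cast; linear_combination hr'⟩
    -- The first relation one index up comes from differentiating the recurrence.
    have hd := congrArg derivative hrec
    simp only [derivative_sub, derivative_mul, derivative_X, derivative_C, derivative_add,
      derivative_natCast, derivative_pow, derivative_one, derivative_ofNat] at hd
    rw [hd]
    push_cast
    linear_combination (X - (2 * (k : ℝ[X]) + 4) * C a) * hl
      - ((k : ℝ[X]) + 1) * ((k : ℝ[X]) + 2) * C a ^ 2 * hr - ((k : ℝ[X]) + 2) * hrec
      - ((k : ℝ[X]) + 1) * ((k : ℝ[X]) + 2) * C a
        * (X * monicLaguerre a k - monicLaguerre a (k + 1)) * hC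

theorem monicLaguerre_monic (a : ℝ) (k : ℕ) : (monicLaguerre a k).Monic :=
  (monicLaguerre_monic_and_natDegree a k).1.1

theorem natDegree_monicLaguerre (a : ℝ) (k : ℕ) : (monicLaguerre a k).natDegree = k :=
  (monicLaguerre_monic_and_natDegree a k).1.2

theorem eval_zero_monicLaguerre (a : ℝ) (k : ℕ) :
    (monicLaguerre a k).eval 0 = (-a) ^ k * (k + 1).factorial ∧
      (monicLaguerre a (k + 1)).eval 0 = (-a) ^ (k + 1) * (k + 2).factorial := by
  induction k with
  | zero => simp [monicLaguerre_zero, monicLaguerre_one]; ring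
  | succ k ih =>
    refine ⟨ih.2, ?_⟩
    rw [show k + 1 + 1 = k + 2 from rfl, monicLaguerre_add_two, eval_sub, eval_mul, eval_mul,
      ih.1, ih.2]
    simp only [eval_sub, eval_X, eval_C, Nat.factorial_succ]
    push_cast
    ring

/-- The squared norm of `monicLaguerre a k` for the weight `t e^{-t/a}` on `[0, ∞)`. -/
noncomputable def laguerreNormSq (a : ℝ) (k : ℕ) : ℝ :=
  k.factorial * (k + 1).factorial * a ^ (2 * k + 2)

theorem laguerreNormSq_succ (a : ℝ) (k : ℕ) :
    laguerreNormSq a (k + 1) = (k + 1) * (k + 2) * a ^ 2 * laguerreNormSq a k := by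
  simp only [laguerreNormSq, Nat.factorial_succ]
  push_cast
  ring

theorem laguerreNormSq_pos {a : ℝ} (ha : 0 < a) (k : ℕ) : 0 < laguerreNormSq a k := by
  unfold laguerreNormSq; positivity

/-- The Christoffel–Darboux identity on the diagonal. -/
theorem X_mul_sum_monicLaguerre_sq {n a : ℝ} (h : n * a = 1) (ha : 0 < a) (m : ℕ) :
    X * ∑ k ∈ Finset.range (m + 1), C (laguerreNormSq a k)⁻¹ * monicLaguerre a k ^ 2
      = C (laguerreNormSq a m)⁻¹ * (((m : ℝ[X]) + 1) * ((m : ℝ[X]) + 2) * C a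
          * monicLaguerre a m ^ 2
        + (2 * (m : ℝ[X]) + 3 - C n * X) * (monicLaguerre a m * monicLaguerre a (m + 1))
        + C n * monicLaguerre a (m + 1) ^ 2) := by
  have hC : C n * C a = 1 := by rw [← C_mul, h, C_1]
  -- The right-hand side is X (p_{m+1}' p_m - p_m' p_{m+1}) / h_m, the confluent Christoffel–Darboux
  -- form, with derivatives removed by the structure relations. The induction needs only the
  -- recurrence.
  induction m with
  | zero =>
    have h2 : C (2 : ℝ) = 2 := rfl
    simp only [Finset.sum_range_one, zero_add, monicLaguerre_zero, monicLaguerre_one, C_mul, h2]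
    push_cast
    linear_combination C (laguerreNormSq a 0)⁻¹ * (2 * X - 4 * C a) * hC
  | succ m ih =>
    rw [Finset.sum_range_succ, mul_add, ih]
    have hs : C (laguerreNormSq a m)⁻¹ = ((m : ℝ[X]) + 1) * ((m : ℝ[X]) + 2) * C a ^ 2
        * C (laguerreNormSq a (m + 1))⁻¹ := by
      have : (laguerreNormSq a m)⁻¹ = ((m : ℝ) + 1) * (m + 2) * a ^ 2
          * (laguerreNormSq a (m + 1))⁻¹ := by
        have := (laguerreNormSq_pos ha m).ne'
        rw [laguerreNormSq_succ]
        field_simp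
      rw [this]
      simp only [C_mul, C_add, C_pow, map_natCast, map_ofNat, map_one]
    have hrec := monicLaguerre_add_two a m
    simp only [C_mul, C_add, C_pow, map_natCast, map_ofNat, map_one] at hrec
    rw [show m + 1 + 1 = m + 2 from rfl, hrec, hs]
    push_cast
    linear_combination C (laguerreNormSq a (m + 1))⁻¹
      * (((m : ℝ[X]) + 1) * ((m : ℝ[X]) + 2) * C a
          * (monicLaguerre a (m + 1) ^ 2 - X * monicLaguerre a m * monicLaguerre a (m + 1))
        + ((X - (2 * (m : ℝ[X]) + 4) * C a) * monicLaguerre a (m + 1)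
            - ((m : ℝ[X]) + 1) * ((m : ℝ[X]) + 2) * C a ^ 2 * monicLaguerre a m)
          * ((2 * (m : ℝ[X]) + 4) * monicLaguerre a (m + 1)
            + ((m : ℝ[X]) + 1) * ((m : ℝ[X]) + 2) * C a * monicLaguerre a m)) * hC

/-! ### The differential equation of the density -/

/-- The polynomial part of `(f e^{-n t})'`. -/
noncomputable def twistedDeriv (n : ℝ) (f : ℝ[X]) : ℝ[X] := derivative f - C n * f

/-- Lagrange's identity for the Laguerre Sturm–Liouville operator: the argument on the left is X²
(p_k p_j' - p_j p_k'), with derivatives removed by the second structure relation. -/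
theorem twistedDeriv_wronskian {n a : ℝ} (h : n * a = 1) (j k : ℕ) :
    twistedDeriv n (X * ((C (k : ℝ) - C (j : ℝ)) * (monicLaguerre a j * monicLaguerre a k)
        - C n * (monicLaguerre a (j + 1) * monicLaguerre a k
          - monicLaguerre a (k + 1) * monicLaguerre a j)))
      = C n * (C (k : ℝ) - C (j : ℝ)) * (X * (monicLaguerre a j * monicLaguerre a k)) := by
  have hC : C n * C a = 1 := by rw [← C_mul, h, C_1]
  obtain ⟨hj, hj'⟩ := X_mul_derivative_monicLaguerre h j
  obtain ⟨hk, hk'⟩ := X_mul_derivative_monicLaguerre h k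
  simp only [twistedDeriv, derivative_sub, derivative_mul, derivative_X, derivative_C,
    map_natCast]
  simp only [derivative_natCast]
  set u := monicLaguerre a j
  set v := monicLaguerre a (j + 1)
  set p := monicLaguerre a k
  set q := monicLaguerre a (k + 1)
  linear_combination ((k : ℝ[X]) - (j : ℝ[X])) * (p * hj' + u * hk')
    - C n * (p * hj + v * hk' - u * hk - q * hj')
    + u * p * (3 * (k : ℝ[X]) + (k : ℝ[X]) ^ 2 - 3 * (j : ℝ[X]) - (j : ℝ[X]) ^ 2) * hC

/-- The operator of the loop equation, transported to polynomials `f` through `f e^{-n t}`,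
annihilates the Christoffel–Darboux quadratic form. -/
theorem laguerre_density_ode {n c : ℝ} {u v f : ℝ[X]}
    (hu : X * derivative u = (C n * X - C n - 1) * u - C n * v)
    (hv : X * derivative v = C n * v + (C n + 1) * u)
    (hf : f = C c * ((C n + 1) * u ^ 2 + (2 * C n + 1 - C n * X) * (u * v) + C n * v ^ 2)) :
    C n ^ 4 * ((-2 * X ^ 2 + 8 * X) * (twistedDeriv n)^[1] f + 4 * f)
      + C n ^ 3 * ((-X ^ 2 + 8 * X) * (twistedDeriv n)^[1] f + 4 * f)
      + C n ^ 2 * (2 * X ^ 2 * (twistedDeriv n)^[3] f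
        + (-X ^ 2 + 12 * X) * (twistedDeriv n)^[2] f + (-X + 12) * (twistedDeriv n)^[1] f + f)
      + C n * (X ^ 2 * (twistedDeriv n)^[3] f + 6 * X * (twistedDeriv n)^[2] f
        + 6 * (twistedDeriv n)^[1] f)
      + (X ^ 2 * (twistedDeriv n)^[4] f + 7 * X * (twistedDeriv n)^[3] f
        + 9 * (twistedDeriv n)^[2] f) = 0 := by
  -- The system only gives X u' and X v', so each twisted derivative costs one more power of X; this
  -- rule keeps everything polynomial.
  have step : ∀ (g r : ℝ[X]) (k : ℕ), X ^ k * g = r →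
      X ^ (k + 1) * twistedDeriv n g = X * derivative r - C n * X * r - (k : ℝ[X]) * r := by
    intro g r k h
    rw [← h, twistedDeriv]
    simp only [derivative_mul, derivative_X_pow, map_natCast]
    rcases k with _ | k
    · simp; ring
    · simp only [Nat.add_sub_cancel]; ring
  have e1 : X * twistedDeriv n f
      = - C c * ((C n + 1) * u ^ 2 + (2 * C n + 1) * (u * v) + C n * v ^ 2) := by
    have := step f _ 0 (by rw [pow_zero, one_mul, hf])
    rw [zero_add, pow_one] at this
    rw [this]
    simp only [derivative_mul, derivative_add, derivative_sub, derivative_pow, derivative_C,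
      derivative_X, derivative_one, derivative_ofNat]
    push_cast
    simp only [map_ofNat]
    linear_combination C c * (2 * (C n + 1) * u * hu + (2 * C n + 1 - C n * X) * (v * hu + u * hv)
      + 2 * C n * v * hv)
  have e2 : X ^ 2 * twistedDeriv n (twistedDeriv n f)
      = C c * ((-(C n ^ 2 + C n) * X + 2 * C n + 2) * u ^ 2 + (4 * C n + 2) * (u * v)
        + (C n ^ 2 * X + 2 * C n) * v ^ 2) := by
    rw [step _ _ 1 (by rw [pow_one, e1])]
    simp only [derivative_mul, derivative_add, derivative_pow, derivative_C, derivative_one,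
      derivative_ofNat, derivative_neg]
    push_cast
    simp only [map_ofNat]
    linear_combination - C c * (2 * (C n + 1) * u * hu + (2 * C n + 1) * (v * hu + u * hv)
      + 2 * C n * v * hv)
  have e3 : X ^ 3 * twistedDeriv n (twistedDeriv n (twistedDeriv n f))
      = C c * ((-(C n ^ 3 + C n ^ 2) * X ^ 2 + (2 * C n ^ 3 + 7 * C n ^ 2 + 5 * C n) * X
          - 6 * C n - 6) * u ^ 2
        + ((4 * C n ^ 3 + 4 * C n ^ 2) * X - 12 * C n - 6) * (u * v)
        + (- C n ^ 3 * X ^ 2 + (2 * C n ^ 3 - 3 * C n ^ 2) * X - 6 * C n) * v ^ 2) := by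
    rw [step _ _ 2 e2]
    simp only [derivative_mul, derivative_add, derivative_pow, derivative_C, derivative_X,
      derivative_ofNat, derivative_neg]
    push_cast
    simp only [map_ofNat]
    linear_combination C c * (2 * (-(C n ^ 2 + C n) * X + 2 * C n + 2) * u * hu
      + (4 * C n + 2) * (v * hu + u * hv) + 2 * (C n ^ 2 * X + 2 * C n) * v * hv)
  have e4 : X ^ 4 * twistedDeriv n (twistedDeriv n (twistedDeriv n (twistedDeriv n f)))
      = C c * ((-(C n ^ 4 + C n ^ 3) * X ^ 3 + (4 * C n ^ 4 + 12 * C n ^ 3 + 8 * C n ^ 2) * X ^ 2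
          - (14 * C n ^ 3 + 40 * C n ^ 2 + 26 * C n) * X + 24 * C n + 24) * u ^ 2
        + (-(28 * C n ^ 3 + 28 * C n ^ 2) * X + 48 * C n + 24) * (u * v)
        + (C n ^ 4 * X ^ 3 + (-4 * C n ^ 4 + 4 * C n ^ 3) * X ^ 2
          + (-14 * C n ^ 3 + 12 * C n ^ 2) * X + 24 * C n) * v ^ 2) := by
    rw [step _ _ 3 e3]
    simp only [derivative_mul, derivative_add, derivative_sub, derivative_pow, derivative_C,
      derivative_X, derivative_ofNat, derivative_neg]
    push_cast
    simp only [map_ofNat]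
    linear_combination C c * (2 * (-(C n ^ 3 + C n ^ 2) * X ^ 2
          + (2 * C n ^ 3 + 7 * C n ^ 2 + 5 * C n) * X - 6 * C n - 6) * u * hu
        + ((4 * C n ^ 3 + 4 * C n ^ 2) * X - 12 * C n - 6) * (v * hu + u * hv)
        + 2 * (- C n ^ 3 * X ^ 2 + (2 * C n ^ 3 - 3 * C n ^ 2) * X - 6 * C n) * v * hv)
  -- A further factor X² lets every term be expressed through `e1`–`e4`; it is cancelled in the
  -- domain ℝ[X].
  refine (mul_eq_zero.mp ?_).resolve_left (pow_ne_zero 2 (X_ne_zero (R := ℝ)))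
  simp only [Function.iterate_succ, Function.iterate_zero, Function.comp_apply, id]
  linear_combination (4 * C n ^ 4 + 4 * C n ^ 3 + C n ^ 2) * X ^ 2 * hf
    + (C n ^ 4 * (-2 * X ^ 2 + 8 * X) + C n ^ 3 * (-X ^ 2 + 8 * X) + C n ^ 2 * (-X + 12)
      + 6 * C n) * X * e1
    + (C n ^ 2 * (-X ^ 2 + 12 * X) + 6 * C n * X + 9) * e2
    + (2 * C n ^ 2 * X + C n * X + 7) * e3 + e4

/-! ### Exponential moments and orthogonality -/

theorem tendsto_eval_mul_exp_neg {n : ℝ} (hn : 0 < n) (f : ℝ[X]) :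
    Tendsto (fun t : ℝ => f.eval t * Real.exp (-n * t)) atTop (𝓝 0) := by
  have h := (Polynomial.tendsto_div_exp_atTop (f.comp (C n⁻¹ * X))).comp
    (tendsto_id.const_mul_atTop hn)
  refine h.congr fun t => ?_
  simp [Real.exp_neg, div_eq_mul_inv, hn.ne']

theorem integrableOn_eval_mul_exp_neg {n : ℝ} (hn : 0 < n) (f : ℝ[X]) :
    IntegrableOn (fun t : ℝ => f.eval t * Real.exp (-n * t)) (Ioi 0) := by
  -- Half of the exponential decay absorbs the polynomial.
  refine integrable_of_isBigO_exp_neg (b := n / 2) (by positivity)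
    (by fun_prop) ?_
  have h := ((tendsto_eval_mul_exp_neg (half_pos hn) f).isBigO_one ℝ).mul
    (Asymptotics.isBigO_refl (fun t : ℝ => Real.exp (-(n / 2) * t)) atTop)
  refine (h.congr (fun t => ?_) fun t => one_mul _)
  rw [mul_assoc, ← Real.exp_add]
  ring_nf

/-- The integral of `f e^{-n t}` over `[0, ∞)`. -/
noncomputable def expMoment (n : ℝ) (f : ℝ[X]) : ℝ :=
  ∫ t in Ioi (0 : ℝ), f.eval t * Real.exp (-n * t)

theorem expMoment_add {n : ℝ} (hn : 0 < n) (f g : ℝ[X]) :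
    expMoment n (f + g) = expMoment n f + expMoment n g := by
  unfold expMoment
  rw [← integral_add (integrableOn_eval_mul_exp_neg hn f) (integrableOn_eval_mul_exp_neg hn g)]
  simp only [eval_add, add_mul]

theorem expMoment_C_mul (n c : ℝ) (f : ℝ[X]) :
    expMoment n (C c * f) = c * expMoment n f := by
  unfold expMoment
  rw [← integral_const_mul]
  simp only [eval_mul, eval_C, mul_assoc]

theorem expMoment_sub {n : ℝ} (hn : 0 < n) (f g : ℝ[X]) :
    expMoment n (f - g) = expMoment n f - expMoment n g := by
  have := expMoment_add hn (f - g) g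
  rw [sub_add_cancel] at this
  linarith

theorem hasDerivAt_eval_mul_exp_neg (n : ℝ) (f : ℝ[X]) (t : ℝ) :
    HasDerivAt (fun t : ℝ => f.eval t * Real.exp (-n * t))
      ((twistedDeriv n f).eval t * Real.exp (-n * t)) t := by
  have h := (f.hasDerivAt t).mul (((hasDerivAt_id t).const_mul (-n)).exp)
  refine h.congr_deriv ?_
  simp only [twistedDeriv, eval_sub, eval_mul, eval_C, id]
  ring

theorem expMoment_twistedDeriv {n : ℝ} (hn : 0 < n) (f : ℝ[X]) :
    expMoment n (twistedDeriv n f) = - f.eval 0 := by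
  have := integral_Ioi_of_hasDerivAt_of_tendsto' (a := (0 : ℝ))
    (fun t _ => hasDerivAt_eval_mul_exp_neg n f t)
    (integrableOn_eval_mul_exp_neg hn (twistedDeriv n f)) (tendsto_eval_mul_exp_neg hn f)
  simpa [expMoment] using this

/-- Up to the nonzero factor n (k - j), the integrand is an exact derivative whose primitive
vanishes at 0 and at infinity. -/
theorem expMoment_X_mul_monicLaguerre_of_ne {n a : ℝ} (hn : 0 < n) (h : n * a = 1) {j k : ℕ}
    (hjk : j ≠ k) : expMoment n (X * (monicLaguerre a j * monicLaguerre a k)) = 0 := by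
  have h1 := congrArg (expMoment n) (twistedDeriv_wronskian h j k)
  rw [expMoment_twistedDeriv hn, ← C_sub, ← C_mul, expMoment_C_mul] at h1
  simp only [eval_mul, eval_X, zero_mul, neg_zero] at h1
  refine (mul_eq_zero.mp h1.symm).resolve_left (mul_ne_zero hn.ne' (sub_ne_zero.mpr ?_))
  exact_mod_cast hjk.symm

theorem expMoment_X {n a : ℝ} (hn : 0 < n) (h : n * a = 1) : expMoment n X = a ^ 2 := by
  have h1 := expMoment_twistedDeriv hn X
  have h2 := expMoment_twistedDeriv hn 1
  have e1 : twistedDeriv n X = 1 - C n * X := by simp [twistedDeriv]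
  have e2 : twistedDeriv n 1 = 0 - C n * 1 := by simp [twistedDeriv]
  have e0 : expMoment n 0 = 0 := by simp [expMoment]
  rw [e1, expMoment_sub hn, expMoment_C_mul, eval_X] at h1
  rw [e2, expMoment_sub hn, expMoment_C_mul, eval_one, e0] at h2
  linear_combination (-a) * h1 - a ^ 2 * h2 - (expMoment n X + a * expMoment n 1) * h

theorem expMoment_X_mul_monicLaguerre_self {n a : ℝ} (hn : 0 < n) (h : n * a = 1) (k : ℕ) :
    expMoment n (X * (monicLaguerre a k * monicLaguerre a k)) = laguerreNormSq a k := by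
  -- Expanding one factor p_{k+1} by the recurrence, orthogonality leaves only X p_k. Below, X
  -- p_{k+1} is expanded in turn and only its p_k component survives, giving the ratio of
  -- consecutive norms.
  have key : ∀ k, expMoment n (X * (monicLaguerre a (k + 1) * monicLaguerre a (k + 1)))
      = expMoment n (X * (X * (monicLaguerre a k * monicLaguerre a (k + 1)))) := by
    intro k
    rcases k with _ | k
    · have : X * (monicLaguerre a 1 * monicLaguerre a 1)
          = X * (X * (monicLaguerre a 0 * monicLaguerre a 1))
            - C (2 * a) * (X * (monicLaguerre a 0 * monicLaguerre a 1)) := by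
        rw [monicLaguerre_zero, monicLaguerre_one]; ring
      rw [zero_add, this, expMoment_sub hn, expMoment_C_mul,
        expMoment_X_mul_monicLaguerre_of_ne hn h zero_ne_one, mul_zero, sub_zero]
    · have : X * (monicLaguerre a (k + 2) * monicLaguerre a (k + 2))
          = X * (X * (monicLaguerre a (k + 1) * monicLaguerre a (k + 2)))
            - C ((2 * k + 4) * a) * (X * (monicLaguerre a (k + 1) * monicLaguerre a (k + 2)))
            - C ((k + 1) * (k + 2) * a ^ 2)
              * (X * (monicLaguerre a k * monicLaguerre a (k + 2))) := by
        nth_rewrite 1 [monicLaguerre_add_two]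
        ring
      rw [show k + 1 + 1 = k + 2 from rfl, this, expMoment_sub hn, expMoment_sub hn,
        expMoment_C_mul, expMoment_C_mul, expMoment_X_mul_monicLaguerre_of_ne hn h (by omega),
        expMoment_X_mul_monicLaguerre_of_ne hn h (by omega), mul_zero, mul_zero, sub_zero,
        sub_zero]
  induction k with
  | zero => simp [monicLaguerre_zero, laguerreNormSq, expMoment_X hn h]
  | succ k ih =>
    have : X * (X * (monicLaguerre a k * monicLaguerre a (k + 1)))
        = X * (monicLaguerre a k * monicLaguerre a (k + 2))
          + C ((2 * k + 4) * a) * (X * (monicLaguerre a k * monicLaguerre a (k + 1)))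
          + C ((k + 1) * (k + 2) * a ^ 2) * (X * (monicLaguerre a k * monicLaguerre a k)) := by
      rw [monicLaguerre_add_two]
      ring
    rw [key, this, expMoment_add hn, expMoment_add hn, expMoment_C_mul, expMoment_C_mul, ih,
      expMoment_X_mul_monicLaguerre_of_ne hn h (by omega),
      expMoment_X_mul_monicLaguerre_of_ne hn h (by omega), laguerreNormSq_succ]
    ring

/-! ### Stieltjes transforms off the cut -/

theorem isOpen_offCut : IsOpen offCut := by
  have : offCut = (Complex.ofReal '' Ici 0)ᶜ := by
    ext x
    simp only [offCut, mem_ofPred_eq, mem_compl_iff, mem_image, mem_Ici, not_exists, not_and]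
    exact forall₂_congr fun r _ => ne_comm
  rw [this, isOpen_compl_iff]
  exact Complex.isometry_ofReal.isClosedEmbedding.isClosedMap _ isClosed_Ici

theorem sub_ofReal_ne_zero {x : ℂ} (hx : x ∈ offCut) {t : ℝ} (ht : 0 ≤ t) : x - (t : ℂ) ≠ 0 :=
  sub_ne_zero.mpr (hx t ht)

/-- A distance bound uniform in y is what dominates the differentiated kernel under the integral. -/
theorem exists_ball_norm_sub_ge {x : ℂ} (hx : x ∈ offCut) :
    ∃ ε > 0, ∀ y ∈ Metric.ball x ε, ∀ t : ℝ, 0 ≤ t → ε ≤ ‖y - t‖ := by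
  obtain ⟨δ, hδ, hb⟩ := Metric.isOpen_iff.mp isOpen_offCut x hx
  refine ⟨δ / 2, half_pos hδ, fun y hy t ht => ?_⟩
  by_contra! hlt
  have : (t : ℂ) ∈ offCut := by
    refine hb ?_
    rw [Metric.mem_ball] at hy ⊢
    rw [← dist_eq_norm, dist_comm] at hlt
    linarith [dist_triangle (t : ℂ) y x]
  exact this t ht rfl

/-- The Stieltjes transform of `f e^{-n t}` on `[0, ∞)`. -/
noncomputable def stieltjes (n : ℝ) (f : ℝ[X]) (x : ℂ) : ℂ :=
  ∫ t in Ioi (0 : ℝ), ((f.eval t * Real.exp (-n * t) : ℝ) : ℂ) * (1 / (x - t))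

theorem exists_norm_one_div_sub_le {x : ℂ} (hx : x ∈ offCut) :
    ∃ B, ∀ t : ℝ, 0 ≤ t → ‖1 / (x - t)‖ ≤ B := by
  obtain ⟨ε, hε, hb⟩ := exists_ball_norm_sub_ge hx
  refine ⟨1 / ε, fun t ht => ?_⟩
  rw [norm_div, norm_one]
  exact one_div_le_one_div_of_le hε (hb x (Metric.mem_ball_self hε) t ht)

theorem integrableOn_stieltjes {n : ℝ} (hn : 0 < n) (f : ℝ[X]) {x : ℂ} (hx : x ∈ offCut) :
    IntegrableOn (fun t : ℝ => ((f.eval t * Real.exp (-n * t) : ℝ) : ℂ) * (1 / (x - t)))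
      (Ioi 0) := by
  obtain ⟨B, hB⟩ := exists_norm_one_div_sub_le hx
  refine (integrableOn_eval_mul_exp_neg hn f).ofReal.mul_bdd (c := B)
    (Measurable.aestronglyMeasurable (by fun_prop)) ?_
  filter_upwards [ae_restrict_mem measurableSet_Ioi] with t ht using hB t (le_of_lt ht)

theorem stieltjes_add {n : ℝ} (hn : 0 < n) (f g : ℝ[X]) {x : ℂ} (hx : x ∈ offCut) :
    stieltjes n (f + g) x = stieltjes n f x + stieltjes n g x := by
  unfold stieltjes
  rw [← integral_add (integrableOn_stieltjes hn f hx) (integrableOn_stieltjes hn g hx)]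
  simp only [eval_add, add_mul, Complex.ofReal_add]

theorem stieltjes_C_mul (n c : ℝ) (f : ℝ[X]) (x : ℂ) :
    stieltjes n (C c * f) x = c * stieltjes n f x := by
  unfold stieltjes
  rw [← integral_const_mul]
  simp only [eval_mul, eval_C, mul_assoc, Complex.ofReal_mul]

/-- This is t/(x - t) = x/(x - t) - 1 under the integral. -/
theorem stieltjes_X_mul {n : ℝ} (hn : 0 < n) (f : ℝ[X]) {x : ℂ} (hx : x ∈ offCut) :
    stieltjes n (X * f) x = x * stieltjes n f x - expMoment n f := by
  unfold stieltjes expMoment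
  rw [← integral_complex_ofReal, ← integral_const_mul]
  refine Eq.trans ?_ (integral_sub ((integrableOn_stieltjes hn f hx).const_mul x)
      (integrableOn_eval_mul_exp_neg hn f).ofReal)
  refine setIntegral_congr_fun measurableSet_Ioi fun t ht => ?_
  have := sub_ofReal_ne_zero hx (le_of_lt ht)
  simp only [eval_mul, eval_X]
  push_cast
  field_simp
  ring

/-- The x-derivative of 1/(x - t) is minus its t-derivative, so integration by parts moves it onto f
e^{-nt}; the endpoint t = 0 leaves f(0)/x. -/
theorem hasDerivAt_stieltjes {n : ℝ} (hn : 0 < n) (f : ℝ[X]) {x : ℂ} (hx : x ∈ offCut) :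
    HasDerivAt (stieltjes n f) (stieltjes n (twistedDeriv n f) x + f.eval 0 / x) x := by
  obtain ⟨ε, hε, hb⟩ := exists_ball_norm_sub_ge hx
  have hm : Measurable fun t : ℝ => ((f.eval t * Real.exp (-n * t) : ℝ) : ℂ) :=
    (by fun_prop : Continuous fun t : ℝ => ((f.eval t * Real.exp (-n * t) : ℝ) : ℂ)).measurable
  have hint := (integrableOn_eval_mul_exp_neg hn f).ofReal (𝕜 := ℂ)
  have h1 := hasDerivAt_integral_of_dominated_loc_of_deriv_le (μ := volume.restrict (Ioi (0 : ℝ)))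
    (F := fun (y : ℂ) (t : ℝ) => ((f.eval t * Real.exp (-n * t) : ℝ) : ℂ) * (1 / (y - t)))
    (F' := fun (y : ℂ) (t : ℝ) => ((f.eval t * Real.exp (-n * t) : ℝ) : ℂ) * (-1 / (y - t) ^ 2))
    (bound := fun t => ‖((f.eval t * Real.exp (-n * t) : ℝ) : ℂ)‖ * (1 / ε ^ 2))
    (Metric.ball_mem_nhds x hε) (.of_forall fun y => (hm.mul (by fun_prop)).aestronglyMeasurable)
    (integrableOn_stieltjes hn f hx) (hm.mul (by fun_prop)).aestronglyMeasurable ?_ (hint.norm.mul_const _) ?_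
  · have h2 := h1.2
    have h3 := integral_Ioi_of_hasDerivAt_of_tendsto' (a := (0 : ℝ)) (m := 0)
      (f := fun t : ℝ => ((f.eval t * Real.exp (-n * t) : ℝ) : ℂ) * (1 / (x - t)))
      (f' := fun t : ℝ =>
        (((twistedDeriv n f).eval t * Real.exp (-n * t) : ℝ) : ℂ) * (1 / (x - t))
        - ((f.eval t * Real.exp (-n * t) : ℝ) : ℂ) * (-1 / (x - t) ^ 2)) ?_ ?_ ?_
    · rw [integral_sub (integrableOn_stieltjes hn _ hx) h1.1] at h3
      refine h2.congr_deriv ?_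
      simp only [Complex.ofReal_zero, mul_zero, Real.exp_zero, sub_zero, mul_one] at h3
      unfold stieltjes
      linear_combination -h3
    · intro t ht
      have ht' := sub_ofReal_ne_zero hx ht
      have hs : HasDerivAt (fun t : ℝ => x - (t : ℂ)) (-1) t := by
        exact ((hasDerivAt_const t x).sub (hasDerivAt_id t).ofReal_comp).congr_deriv (by simp)
      have := ((hasDerivAt_eval_mul_exp_neg n f t).ofReal_comp).mul
        ((hasDerivAt_const t (1 : ℂ)).div hs ht')
      refine this.congr_deriv ?_
      simp only [Pi.div_apply]
      ring
    · exact (integrableOn_stieltjes hn _ hx).sub h1.1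
    · obtain ⟨B, hB⟩ := exists_norm_one_div_sub_le hx
      have h0 : Tendsto (fun t : ℝ => ((f.eval t * Real.exp (-n * t) : ℝ) : ℂ)) atTop (𝓝 0) := by
        exact_mod_cast (tendsto_eval_mul_exp_neg hn f).ofReal
      refine h0.zero_mul_isBoundedUnder_le ⟨B, ?_⟩
      simp only [eventually_map]
      filter_upwards [eventually_ge_atTop 0] with t ht using hB t ht
  · filter_upwards [ae_restrict_mem measurableSet_Ioi] with t ht y hy
    rw [norm_mul, norm_div, norm_neg, norm_one, norm_pow]
    have := hb y hy t (le_of_lt ht)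
    gcongr
  · filter_upwards [ae_restrict_mem measurableSet_Ioi] with t ht y hy
    have hy' : y - (t : ℂ) ≠ 0 := by
      have := hb y hy t (le_of_lt ht)
      exact norm_pos_iff.mp (hε.trans_le this)
    have := ((hasDerivAt_const y (1 : ℂ)).div ((hasDerivAt_id y).sub_const (t : ℂ)) hy').const_mul
      ((f.eval t * Real.exp (-n * t) : ℝ) : ℂ)
    exact this.congr_deriv (by simp)

/-! ### The density polynomial: mass, behaviour at 0, differential equation -/

/-- The polynomial `f` for which `f e^{-N t}` is the normalized one-point density of the
ensemble with weight `t e^{-N t}`. -/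
noncomputable def densityPoly (N : ℕ) : ℝ[X] :=
  C (N : ℝ)⁻¹ * (X * ∑ k ∈ Finset.range N,
    C (laguerreNormSq (N : ℝ)⁻¹ k)⁻¹ * monicLaguerre (N : ℝ)⁻¹ k ^ 2)

theorem expMoment_sum {ι : Type*} {n : ℝ} (hn : 0 < n) (s : Finset ι) (f : ι → ℝ[X]) :
    expMoment n (∑ i ∈ s, f i) = ∑ i ∈ s, expMoment n (f i) := by
  classical
  induction s using Finset.induction_on with
  | empty => simp [expMoment]
  | insert i s hi ih => rw [Finset.sum_insert hi, Finset.sum_insert hi, expMoment_add hn, ih]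

theorem expMoment_densityPoly {N : ℕ} (hN : 1 ≤ N) : expMoment N (densityPoly N) = 1 := by
  have hn : (0 : ℝ) < N := by exact_mod_cast hN
  rw [densityPoly, expMoment_C_mul, Finset.mul_sum, expMoment_sum hn]
  have : ∀ k ∈ Finset.range N, expMoment N (X * (C (laguerreNormSq (N : ℝ)⁻¹ k)⁻¹
      * monicLaguerre (N : ℝ)⁻¹ k ^ 2)) = 1 := by
    intro k _
    rw [show X * (C (laguerreNormSq (N : ℝ)⁻¹ k)⁻¹ * monicLaguerre (N : ℝ)⁻¹ k ^ 2)
        = C (laguerreNormSq (N : ℝ)⁻¹ k)⁻¹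
          * (X * (monicLaguerre (N : ℝ)⁻¹ k * monicLaguerre (N : ℝ)⁻¹ k)) by ring,
      expMoment_C_mul, expMoment_X_mul_monicLaguerre_self hn (mul_inv_cancel₀ hn.ne')]
    exact inv_mul_cancel₀ (laguerreNormSq_pos (inv_pos.mpr hn) k).ne'
  rw [Finset.sum_congr rfl this]
  simp [hn.ne']

theorem eval_zero_densityPoly (N : ℕ) : (densityPoly N).eval 0 = 0 := by
  simp [densityPoly]

theorem eval_zero_derivative_densityPoly {N : ℕ} (hN : 1 ≤ N) :
    (derivative (densityPoly N)).eval 0 = (N : ℝ) ^ 2 * (N + 1) / 2 := by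
  have hn : (0 : ℝ) < N := by exact_mod_cast hN
  rw [densityPoly, derivative_C_mul, derivative_mul, derivative_X]
  simp only [eval_mul, eval_C, eval_add, eval_X, zero_mul, add_zero, one_mul,
    eval_finsetSum, eval_pow]
  -- Since p_k(0) = (-a)^k (k+1)! and h_k = k! (k+1)! a^{2k+2}, the quotient p_k(0)²/h_k is
  -- (k+1)/a², with a = 1/N.
  have : ∀ k ∈ Finset.range N, (laguerreNormSq (N : ℝ)⁻¹ k)⁻¹
      * (monicLaguerre (N : ℝ)⁻¹ k).eval 0 ^ 2 = N ^ 2 * ((k : ℝ) + 1) := by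
    intro k _
    have h1 : (0 : ℝ) < k.factorial := by positivity
    rw [(eval_zero_monicLaguerre _ k).1, laguerreNormSq, mul_pow, ← pow_mul, mul_comm k 2, pow_mul,
      neg_sq, ← pow_mul, pow_add, Nat.factorial_succ]
    push_cast
    field_simp
  rw [Finset.sum_congr rfl this, ← Finset.mul_sum]
  have hs : ∀ m : ℕ, ∑ k ∈ Finset.range m, ((k : ℝ) + 1) = m * (m + 1) / 2 := by
    intro m
    induction m with
    | zero => simp
    | succ m ih => rw [Finset.sum_range_succ, ih]; push_cast; ring
  rw [hs]
  field_simp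

theorem densityPoly_ode {N : ℕ} (hN : 1 ≤ N) :
    C (N : ℝ) ^ 4 * ((-2 * X ^ 2 + 8 * X) * (twistedDeriv N)^[1] (densityPoly N)
        + 4 * densityPoly N)
      + C (N : ℝ) ^ 3 * ((-X ^ 2 + 8 * X) * (twistedDeriv N)^[1] (densityPoly N)
        + 4 * densityPoly N)
      + C (N : ℝ) ^ 2 * (2 * X ^ 2 * (twistedDeriv N)^[3] (densityPoly N)
        + (-X ^ 2 + 12 * X) * (twistedDeriv N)^[2] (densityPoly N)
        + (-X + 12) * (twistedDeriv N)^[1] (densityPoly N) + densityPoly N)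
      + C (N : ℝ) * (X ^ 2 * (twistedDeriv N)^[3] (densityPoly N)
        + 6 * X * (twistedDeriv N)^[2] (densityPoly N)
        + 6 * (twistedDeriv N)^[1] (densityPoly N))
      + (X ^ 2 * (twistedDeriv N)^[4] (densityPoly N)
        + 7 * X * (twistedDeriv N)^[3] (densityPoly N)
        + 9 * (twistedDeriv N)^[2] (densityPoly N)) = 0 := by
  obtain ⟨m, rfl⟩ : ∃ m, N = m + 1 := ⟨N - 1, by omega⟩
  have hn : (0 : ℝ) < (m + 1 : ℕ) := by positivity
  have h := mul_inv_cancel₀ hn.ne'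
  have hC : C ((m + 1 : ℕ) : ℝ) * C ((m + 1 : ℕ) : ℝ)⁻¹ = 1 := by rw [← C_mul, h, C_1]
  obtain ⟨h1, h2⟩ := X_mul_derivative_monicLaguerre h m
  have h3 := X_mul_sum_monicLaguerre_sq h (inv_pos.mpr hn) m
  have hm : C ((m + 1 : ℕ) : ℝ) = (m : ℝ[X]) + 1 := by simp
  refine laguerre_density_ode (u := monicLaguerre ((m + 1 : ℕ) : ℝ)⁻¹ m)
    (v := monicLaguerre ((m + 1 : ℕ) : ℝ)⁻¹ (m + 1))
    (c := ((m + 1 : ℕ) : ℝ)⁻¹ * (laguerreNormSq ((m + 1 : ℕ) : ℝ)⁻¹ m)⁻¹) ?_ ?_ ?_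
  · rw [h2]
    linear_combination monicLaguerre ((m + 1 : ℕ) : ℝ)⁻¹ m * hm
  · rw [h1]
    rw [hm] at hC ⊢
    linear_combination ((m : ℝ[X]) + 2) * monicLaguerre ((m + 1 : ℕ) : ℝ)⁻¹ m * hC
  · rw [densityPoly, h3, C_mul]
    rw [hm] at hC ⊢
    linear_combination C ((m + 1 : ℕ) : ℝ)⁻¹ * C (laguerreNormSq ((m + 1 : ℕ) : ℝ)⁻¹ m)⁻¹
      * ((m : ℝ[X]) + 2) * monicLaguerre ((m + 1 : ℕ) : ℝ)⁻¹ m ^ 2 * hC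

/-! ### Transporting the equation to the Stieltjes transform -/

theorem iteratedDeriv_succ_eq_of_eqOn {s : Set ℂ} (hs : IsOpen s) {g F : ℂ → ℂ} {k : ℕ}
    (h : EqOn (iteratedDeriv k g) F s) {F' : ℂ → ℂ} (hF : ∀ x ∈ s, HasDerivAt F (F' x) x) :
    EqOn (iteratedDeriv (k + 1) g) F' s := by
  intro x hx
  rw [iteratedDeriv_succ]
  exact ((hF x hx).congr_of_eventuallyEq (h.eventuallyEq_of_mem (hs.mem_nhds hx))).deriv

/-- Each differentiation adds a pole at 0 and differentiates the earlier ones; f(0) = 0 removes the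
first. Agreement of g with the transform on the open set `offCut` suffices. -/
theorem stieltjes_iteratedDeriv {n : ℝ} (hn : 0 < n) {f : ℝ[X]} (hf : f.eval 0 = 0) {g : ℂ → ℂ}
    (hg : EqOn g (stieltjes n f) offCut) {x : ℂ} (hx : x ∈ offCut) :
    iteratedDeriv 0 g x = stieltjes n f x ∧
    iteratedDeriv 1 g x = stieltjes n ((twistedDeriv n)^[1] f) x ∧
    iteratedDeriv 2 g x = stieltjes n ((twistedDeriv n)^[2] f) x
      + ((twistedDeriv n)^[1] f).eval 0 / x ∧
    iteratedDeriv 3 g x = stieltjes n ((twistedDeriv n)^[3] f) x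
      + ((twistedDeriv n)^[2] f).eval 0 / x - ((twistedDeriv n)^[1] f).eval 0 / x ^ 2 ∧
    iteratedDeriv 4 g x = stieltjes n ((twistedDeriv n)^[4] f) x
      + ((twistedDeriv n)^[3] f).eval 0 / x - ((twistedDeriv n)^[2] f).eval 0 / x ^ 2
      + 2 * ((twistedDeriv n)^[1] f).eval 0 / x ^ 3 := by
  have hS : ∀ k, ∀ y ∈ offCut, HasDerivAt (stieltjes n ((twistedDeriv n)^[k] f))
      (stieltjes n ((twistedDeriv n)^[k + 1] f) y + ((twistedDeriv n)^[k] f).eval 0 / y) y := by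
    intro k y hy
    rw [Function.iterate_succ_apply']
    exact hasDerivAt_stieltjes hn _ hy
  have h0 : ∀ y ∈ offCut, y ≠ 0 := fun y hy => by simpa using hy 0 le_rfl
  have hpow : ∀ (c : ℂ) (k : ℕ), ∀ y ∈ offCut,
      HasDerivAt (fun z => c / z ^ (k + 1)) (-(k + 1) * c / y ^ (k + 2)) y := by
    intro c k y hy
    have hy0 := h0 y hy
    have := (hasDerivAt_const y c).div (hasDerivAt_pow (k + 1) y) (pow_ne_zero _ hy0)
    refine this.congr_deriv ?_
    rw [Nat.add_sub_cancel]
    push_cast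
    field_simp
    ring
  have e0 : EqOn (iteratedDeriv 0 g) (stieltjes n ((twistedDeriv n)^[0] f)) offCut := by
    rw [iteratedDeriv_zero]; exact hg
  have e1 := iteratedDeriv_succ_eq_of_eqOn (F' := stieltjes n ((twistedDeriv n)^[1] f))
    isOpen_offCut e0 fun y hy => (hS 0 y hy).congr_deriv (by simp [hf])
  have e2 := iteratedDeriv_succ_eq_of_eqOn isOpen_offCut e1 (hS 1)
  have e3 := iteratedDeriv_succ_eq_of_eqOn isOpen_offCut e2 fun y hy =>
    (hS 2 y hy).add ((hpow (((twistedDeriv n)^[1] f).eval 0 : ℝ) 0 y hy).congr_of_eventuallyEq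
      (.of_forall fun z => by simp only [zero_add, pow_one]))
  have e4 := iteratedDeriv_succ_eq_of_eqOn isOpen_offCut e3 fun y hy =>
    ((hS 3 y hy).add ((hpow (((twistedDeriv n)^[2] f).eval 0 : ℝ) 0 y hy).congr_of_eventuallyEq
      (.of_forall fun z => by simp only [zero_add, pow_one]))).add
      (hpow (-((0 : ℕ) + 1) * (((twistedDeriv n)^[1] f).eval 0 : ℝ)) 1 y hy)
  refine ⟨e0 hx, e1 hx, e2 hx, (e3 hx).trans ?_, (e4 hx).trans ?_⟩
  · push_cast; ring
  · push_cast; ring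

theorem expMoment_X_mul_twistedDeriv {n : ℝ} (hn : 0 < n) (f : ℝ[X]) :
    expMoment n (X * twistedDeriv n f) = - expMoment n f := by
  have h := expMoment_twistedDeriv hn (X * f)
  have e : twistedDeriv n (X * f) = f + X * twistedDeriv n f := by
    simp only [twistedDeriv, derivative_mul, derivative_X]; ring
  rw [e, expMoment_add hn] at h
  simp only [eval_mul, eval_X, zero_mul, neg_zero] at h
  linarith

theorem stieltjes_densityPoly_ode {N : ℕ} (hN : 1 ≤ N) {g : ℂ → ℂ}
    (hg : EqOn g (stieltjes N (densityPoly N)) offCut) {x : ℂ} (hx : x ∈ offCut) :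
    (N : ℂ) ^ 2 * ((-2 * x ^ 2 + 8 * x) * iteratedDeriv 1 g x + 4 * iteratedDeriv 0 g x)
      + (N : ℂ) * ((-x ^ 2 + 8 * x) * iteratedDeriv 1 g x + 4 * iteratedDeriv 0 g x)
      + (2 * x ^ 2 * iteratedDeriv 3 g x + (-x ^ 2 + 12 * x) * iteratedDeriv 2 g x
        + (-x + 12) * iteratedDeriv 1 g x + iteratedDeriv 0 g x)
      + (N : ℂ)⁻¹ * (x ^ 2 * iteratedDeriv 3 g x + 6 * x * iteratedDeriv 2 g x
        + 6 * iteratedDeriv 1 g x)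
      + ((N : ℂ) ^ 2)⁻¹ * (x ^ 2 * iteratedDeriv 4 g x + 7 * x * iteratedDeriv 3 g x
        + 9 * iteratedDeriv 2 g x)
    = 2 * (N : ℂ) ^ 2 + (N : ℂ) + (2 * (N : ℂ) + 2) / x := by
  have hn : (0 : ℝ) < N := by exact_mod_cast hN
  have hx0 : x ≠ 0 := by simpa using hx 0 le_rfl
  have hf0 := eval_zero_densityPoly N
  obtain ⟨w0, w1, w2, w3, w4⟩ := stieltjes_iteratedDeriv hn hf0 hg hx
  have hode := densityPoly_ode hN
  have hd : ((twistedDeriv N)^[1] (densityPoly N)).eval 0 = (N : ℝ) ^ 2 * (N + 1) / 2 := by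
    simp only [Function.iterate_one, twistedDeriv, eval_sub, eval_mul, hf0, mul_zero, sub_zero]
    exact eval_zero_derivative_densityPoly hN
  rw [hd] at w2 w3 w4
  have m1 := expMoment_twistedDeriv hn (densityPoly N)
  have m2 := expMoment_twistedDeriv hn ((twistedDeriv N)^[1] (densityPoly N))
  have m3 := expMoment_twistedDeriv hn ((twistedDeriv N)^[2] (densityPoly N))
  have m4 := expMoment_twistedDeriv hn ((twistedDeriv N)^[3] (densityPoly N))
  have x1 := expMoment_X_mul_twistedDeriv hn (densityPoly N)
  have x2 := expMoment_X_mul_twistedDeriv hn ((twistedDeriv N)^[1] (densityPoly N))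
  have x3 := expMoment_X_mul_twistedDeriv hn ((twistedDeriv N)^[2] (densityPoly N))
  have x4 := expMoment_X_mul_twistedDeriv hn ((twistedDeriv N)^[3] (densityPoly N))
  have i1 : twistedDeriv N (densityPoly N) = (twistedDeriv N)^[1] (densityPoly N) := rfl
  have i2 : twistedDeriv N ((twistedDeriv N)^[1] (densityPoly N))
      = (twistedDeriv N)^[2] (densityPoly N) := rfl
  have i3 : twistedDeriv N ((twistedDeriv N)^[2] (densityPoly N))
      = (twistedDeriv N)^[3] (densityPoly N) := rfl
  have i4 : twistedDeriv N ((twistedDeriv N)^[3] (densityPoly N))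
      = (twistedDeriv N)^[4] (densityPoly N) := rfl
  rw [i1, hf0, neg_zero] at m1
  rw [i1, expMoment_densityPoly hN] at x1
  rw [i2, hd] at m2
  rw [i2, m1, neg_zero] at x2
  rw [i3] at m3
  rw [i3, m2, neg_neg] at x3
  rw [i4] at m4
  rw [i4, m3, neg_neg] at x4
  clear i1 i2 i3 i4
  -- From here only the recorded moments and boundary values matter. The values of the second and
  -- third twisted derivatives at 0 stay unknown and cancel at the end.
  generalize (twistedDeriv N)^[1] (densityPoly N) = f1 at *
  generalize (twistedDeriv N)^[2] (densityPoly N) = f2 at *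
  generalize (twistedDeriv N)^[3] (densityPoly N) = f3 at *
  generalize (twistedDeriv N)^[4] (densityPoly N) = f4 at *
  generalize densityPoly N = f at *
  -- The equation, already scaled by N², is regrouped into constants times nested products X * (X *
  -- ·), the shape that linearity and `stieltjes_X_mul` can rewrite.
  have hop : C (-2 * (N : ℝ) ^ 4 - (N : ℝ) ^ 3) * (X * (X * f1))
      + C (8 * (N : ℝ) ^ 4 + 8 * (N : ℝ) ^ 3 - (N : ℝ) ^ 2) * (X * f1)
      + C (12 * (N : ℝ) ^ 2 + 6 * N) * f1
      + C (4 * (N : ℝ) ^ 4 + 4 * (N : ℝ) ^ 3 + (N : ℝ) ^ 2) * f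
      + C (2 * (N : ℝ) ^ 2 + N) * (X * (X * f3)) + C (-(N : ℝ) ^ 2) * (X * (X * f2))
      + C (12 * (N : ℝ) ^ 2 + 6 * N) * (X * f2) + C 1 * (X * (X * f4)) + C 7 * (X * f3)
      + C 9 * f2 = 0 := by
    rw [← hode]
    simp only [C_add, C_sub, C_mul, C_pow, C_neg, C_1, map_ofNat]
    ring
  have hS := congrArg (fun p => stieltjes N p x) hop
  have hz : stieltjes N 0 x = 0 := by simp [stieltjes]
  simp only [stieltjes_add hn _ _ hx, stieltjes_C_mul, stieltjes_X_mul hn _ hx, hz, m1, m2, m3,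
    m4, x1, x2, x3, x4] at hS
  rw [w0, w1, w2, w3, w4]
  have hN0 : (N : ℂ) ≠ 0 := by exact_mod_cast hn.ne'
  push_cast at hS ⊢
  field_simp
  field_simp at hS
  linear_combination x * hS

/-! ### One-point statistics of the determinantal ensemble -/

theorem perm_eq_of_eq_off_point {ι : Type*} {σ τ : Equiv.Perm ι} (m : ι)
    (h : ∀ i, i ≠ m → σ i = τ i) : σ = τ := by
  ext i
  by_cases hi : i = m
  · subst hi
    by_contra hne
    have hj : τ.symm (σ i) ≠ i := fun hj => hne (by rw [← hj, Equiv.apply_symm_apply, hj])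
    have := h _ hj
    rw [Equiv.apply_symm_apply] at this
    exact hj (σ.injective this)
  · exact h i hi

/-- The one-point statistics of a determinantal ensemble with orthogonal functions `p`: the
integral of `det (p_j (l_i))² ∏ w (l_i) ∑ g (l_i)`. -/
theorem integral_det_sq_mul_sum {N : ℕ} {ν : Measure ℝ} [SigmaFinite ν] {p : Fin N → ℝ → ℝ}
    {w : ℝ → ℝ} {h : Fin N → ℝ} (hint : ∀ i j, Integrable (fun t => p i t * p j t * w t) ν)
    (horth : ∀ i j, i ≠ j → ∫ t, p i t * p j t * w t ∂ν = 0)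
    (hnorm : ∀ i, ∫ t, p i t * p i t * w t ∂ν = h i) (h0 : ∀ i, h i ≠ 0) {g : ℝ → ℂ}
    (hg : AEStronglyMeasurable g ν) {B : ℝ} (hB : ∀ᵐ t ∂ν, ‖g t‖ ≤ B) :
    Integrable (fun l : Fin N → ℝ =>
      (((Matrix.of fun i j => p j (l i)).det ^ 2 * ∏ i, w (l i) : ℝ) : ℂ) * ∑ m, g (l m))
      (Measure.pi fun _ => ν) ∧
    ∫ l : Fin N → ℝ, (((Matrix.of fun i j => p j (l i)).det ^ 2 * ∏ i, w (l i) : ℝ) : ℂ)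
        * ∑ m, g (l m) ∂(Measure.pi fun _ => ν)
      = N.factorial * ((∏ i, h i : ℝ) : ℂ)
        * ∑ k, (h k : ℂ)⁻¹ * ∫ t, ((p k t * p k t * w t : ℝ) : ℂ) * g t ∂ν := by
  classical
  -- Expanding both determinants, the term (σ, τ, m) is a product of one-variable factors, with g
  -- attached only at site m.
  set G : Equiv.Perm (Fin N) → Equiv.Perm (Fin N) → Fin N → Fin N → ℝ → ℂ := fun σ τ m i t =>
    ((p (σ i) t * p (τ i) t * w t : ℝ) : ℂ) * (if i = m then g t else 1) with hG
  have hGint : ∀ σ τ m i, Integrable (G σ τ m i) ν := by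
    intro σ τ m i
    by_cases him : i = m
    · simp only [hG, him, if_true]
      exact (hint _ _).ofReal.mul_bdd (c := B) hg hB
    · simp only [hG, him, if_false, mul_one]
      exact (hint _ _).ofReal
  have hexp : (fun l : Fin N → ℝ =>
      (((Matrix.of fun i j => p j (l i)).det ^ 2 * ∏ i, w (l i) : ℝ) : ℂ) * ∑ m, g (l m))
      = fun l => ∑ m, ∑ σ : Equiv.Perm (Fin N), ∑ τ : Equiv.Perm (Fin N),
        (((Equiv.Perm.sign σ : ℤ) : ℂ) * ((Equiv.Perm.sign τ : ℤ) : ℂ)) * ∏ i, G σ τ m i (l i) := by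
    funext l
    rw [← Matrix.det_transpose, Matrix.det_apply', Finset.mul_sum]
    refine Finset.sum_congr rfl fun m _ => ?_
    rw [sq, Finset.sum_mul_sum, Finset.sum_mul]
    push_cast
    rw [Finset.sum_mul]
    refine Finset.sum_congr rfl fun σ _ => ?_
    rw [Finset.sum_mul, Finset.sum_mul]
    refine Finset.sum_congr rfl fun τ _ => ?_
    simp only [hG, Finset.prod_mul_distrib, Finset.prod_ite_eq', Finset.mem_univ, if_true,
      Matrix.transpose_apply, Matrix.of_apply, Complex.ofReal_mul]
    ring
  have hterm : ∀ m σ τ, Integrable (fun l : Fin N → ℝ =>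
      (((Equiv.Perm.sign σ : ℤ) : ℂ) * ((Equiv.Perm.sign τ : ℤ) : ℂ)) * ∏ i, G σ τ m i (l i))
      (Measure.pi fun _ => ν) := fun m σ τ =>
    (Integrable.fintype_prod fun i => hGint σ τ m i).const_mul _
  rw [hexp]
  refine ⟨integrable_finsetSum _ fun m _ => integrable_finsetSum _ fun σ _ =>
    integrable_finsetSum _ fun τ _ => hterm m σ τ, ?_⟩
  set I : Fin N → ℂ := fun k => (h k : ℂ)⁻¹ * ∫ t, ((p k t * p k t * w t : ℝ) : ℂ) * g t ∂ν with hI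
  -- Distinct permutations cannot differ at a single point, so some site other than m carries a
  -- vanishing orthogonality integral.
  have hoff : ∀ m (σ τ : Equiv.Perm (Fin N)), σ ≠ τ → ∏ i, ∫ t, G σ τ m i t ∂ν = 0 := by
    intro m σ τ hne
    obtain ⟨i, him, hi⟩ : ∃ i, i ≠ m ∧ σ i ≠ τ i := by
      by_contra! hcon
      exact hne (perm_eq_of_eq_off_point m hcon)
    refine Finset.prod_eq_zero (Finset.mem_univ i) ?_
    simp only [hG, him, if_false, mul_one]
    rw [integral_complex_ofReal, horth _ _ hi, Complex.ofReal_zero]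
  have hdiag : ∀ m (σ : Equiv.Perm (Fin N)),
      ∏ i, ∫ t, G σ σ m i t ∂ν = ((∏ i, h i : ℝ) : ℂ) * I (σ m) := by
    intro m σ
    have hh : ∀ i, (h i : ℂ) ≠ 0 := fun i => by exact_mod_cast h0 i
    rw [← Finset.mul_prod_erase _ _ (Finset.mem_univ m), ← Equiv.prod_comp σ h,
      ← Finset.mul_prod_erase _ (fun i => h (σ i)) (Finset.mem_univ m)]
    have : ∀ i ∈ Finset.univ.erase m, ∫ t, G σ σ m i t ∂ν = (h (σ i) : ℂ) := by
      intro i hi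
      simp only [hG, Finset.ne_of_mem_erase hi, if_false, mul_one]
      rw [integral_complex_ofReal, hnorm]
    rw [Finset.prod_congr rfl this]
    simp only [hG, hI, if_true]
    push_cast
    field_simp [hh (σ m)]
  rw [integral_finsetSum _ fun m _ => integrable_finsetSum _ fun σ _ =>
    integrable_finsetSum _ fun τ _ => hterm m σ τ]
  have hm : ∀ m, ∫ l : Fin N → ℝ, ∑ σ : Equiv.Perm (Fin N), ∑ τ : Equiv.Perm (Fin N),
      (((Equiv.Perm.sign σ : ℤ) : ℂ) * ((Equiv.Perm.sign τ : ℤ) : ℂ)) * ∏ i, G σ τ m i (l i)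
        ∂(Measure.pi fun _ => ν)
      = ∑ σ : Equiv.Perm (Fin N), ((∏ i, h i : ℝ) : ℂ) * I (σ m) := by
    intro m
    rw [integral_finsetSum _ fun σ _ => integrable_finsetSum _ fun τ _ => hterm m σ τ]
    refine Finset.sum_congr rfl fun σ _ => ?_
    rw [integral_finsetSum _ fun τ _ => hterm m σ τ, Finset.sum_eq_single σ]
    · rw [integral_const_mul, integral_fintype_prod_eq_prod, hdiag]
      rcases Int.units_eq_one_or (Equiv.Perm.sign σ) with hs | hs <;> simp [hs]
    · intro τ _ hτ
      rw [integral_const_mul, integral_fintype_prod_eq_prod, hoff m σ τ hτ.symm, mul_zero]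
    · simp
  rw [Finset.sum_congr rfl fun m _ => hm m, Finset.sum_comm]
  simp only [← Finset.mul_sum]
  -- Summing over sites m removes the dependence on σ, so the permutations contribute N!.
  rw [Finset.sum_congr rfl fun σ _ => Equiv.sum_comp σ I]
  simp [Fintype.card_perm, hI]
  ring

theorem volume_restrict_orthant (N : ℕ) :
    (volume : Measure (Fin N → ℝ)).restrict (orthant N)
      = Measure.pi fun _ => volume.restrict (Ioi (0 : ℝ)) := by
  have : orthant N = Set.univ.pi fun _ => Ici (0 : ℝ) := by
    ext l
    simp only [orthant, mem_ofPred_eq, Set.mem_pi, mem_univ, mem_Ici, true_implies]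
  rw [this, volume_pi, Measure.restrict_pi_pi]
  simp only [restrict_Ioi_eq_restrict_Ici]

/-- Replacing monomials by monic polynomials of the same degrees preserves the Vandermonde
determinant; squaring removes the sign from the order of the differences. -/
theorem vandermondeProd_sq_eq_det {N : ℕ} (a : ℝ) (l : Fin N → ℝ) :
    vandermondeProd l ^ 2
      = (Matrix.of fun i j : Fin N => (monicLaguerre a j).eval (l i)).det ^ 2 := by
  rw [← Matrix.det_eval_matrixOfPolynomials_eq_det_vandermonde l (fun j => monicLaguerre a j)
    (fun j => natDegree_monicLaguerre a j) (fun j => monicLaguerre_monic a j),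
    Matrix.det_vandermonde, vandermondeProd]
  simp only [← Finset.prod_pow]
  exact Finset.prod_congr rfl fun i _ => Finset.prod_congr rfl fun j _ => by ring

/-- One-point statistics of the Laguerre ensemble in terms of its density polynomial. -/
theorem integral_eigenDensity_mul_sum {N : ℕ} (hN : 1 ≤ N) {g : ℝ → ℂ} (hg : Measurable g)
    {B : ℝ} (hB : ∀ t, 0 ≤ t → ‖g t‖ ≤ B) :
    IntegrableOn (fun l : Fin N → ℝ => (eigenDensity 1 N l : ℂ) * ∑ m, g (l m)) (orthant N) ∧
    ∫ l in orthant N, (eigenDensity 1 N l : ℂ) * ∑ m, g (l m)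
      = N.factorial * ((∏ i : Fin N, laguerreNormSq (N : ℝ)⁻¹ i : ℝ) : ℂ)
        * (N * ∫ t in Ioi (0 : ℝ),
            (((densityPoly N).eval t * Real.exp (-N * t) : ℝ) : ℂ) * g t) := by
  have hn : (0 : ℝ) < N := by exact_mod_cast hN
  have h1 := mul_inv_cancel₀ hn.ne'
  set a : ℝ := (N : ℝ)⁻¹ with ha
  have hB' : ∀ᵐ t ∂(volume.restrict (Ioi (0 : ℝ))), ‖g t‖ ≤ B := by
    filter_upwards [ae_restrict_mem measurableSet_Ioi] with t ht using hB t (le_of_lt ht)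
  have hpoly : ∀ j k : ℕ, (fun t : ℝ => (monicLaguerre a j).eval t * (monicLaguerre a k).eval t
      * (t ^ 1 * Real.exp (-N * t))) = fun t : ℝ =>
        (X * (monicLaguerre a j * monicLaguerre a k)).eval t * Real.exp (-N * t) := by
    intro j k
    funext t
    simp only [eval_mul, eval_X]
    ring
  have key := integral_det_sq_mul_sum (N := N) (ν := volume.restrict (Ioi (0 : ℝ)))
    (p := fun j t => (monicLaguerre a j).eval t) (w := fun t => t ^ 1 * Real.exp (-N * t))
    (h := fun j => laguerreNormSq a j)
    (fun i j => by rw [hpoly]; exact integrableOn_eval_mul_exp_neg hn _)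
    (fun i j hij => by
      rw [hpoly]
      exact expMoment_X_mul_monicLaguerre_of_ne hn h1 (fun h => hij (Fin.ext h)))
    (fun i => by rw [hpoly]; exact expMoment_X_mul_monicLaguerre_self hn h1 i)
    (fun i => (laguerreNormSq_pos (inv_pos.mpr hn) i).ne') hg.aestronglyMeasurable hB'
  rw [← volume_restrict_orthant] at key
  simp only [← vandermondeProd_sq_eq_det] at key
  refine ⟨key.1, key.2.trans ?_⟩
  congr 1
  have hterm : ∀ k : ℕ, IntegrableOn (fun t : ℝ =>
      (((X * (monicLaguerre a k * monicLaguerre a k)).eval t * Real.exp (-N * t) : ℝ) : ℂ) * g t)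
      (Ioi 0) := fun k =>
    (integrableOn_eval_mul_exp_neg hn _).ofReal.mul_bdd (c := B) hg.aestronglyMeasurable hB'
  simp only [fun k : ℕ => fun t : ℝ => congrFun (hpoly k k) t]
  simp only [← integral_const_mul]
  rw [Fin.sum_univ_eq_sum_range (fun k : ℕ => ∫ t in Ioi (0 : ℝ), (laguerreNormSq a k : ℂ)⁻¹ *
    (((eval t (X * (monicLaguerre a k * monicLaguerre a k)) * Real.exp (-N * t) : ℝ) : ℂ) * g t)) N,
    ← integral_finsetSum _ fun k _ => (hterm k).const_mul _]
  refine integral_congr_ae (.of_forall fun t => ?_)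
  have hN0 : (N : ℂ) ≠ 0 := by exact_mod_cast hn.ne'
  simp only [densityPoly, ← ha, eval_mul, eval_C, eval_X, eval_finsetSum, eval_pow]
  push_cast
  simp only [Finset.mul_sum, Finset.sum_mul]
  refine Finset.sum_congr rfl fun k _ => ?_
  rw [ha]
  push_cast
  field_simp

theorem integral_eigenDensity {N : ℕ} (hN : 1 ≤ N) :
    IntegrableOn (eigenDensity 1 N) (orthant N) ∧
      partitionFn 1 N = N.factorial * ∏ i : Fin N, laguerreNormSq (N : ℝ)⁻¹ i := by
  have hn : (0 : ℝ) < N := by exact_mod_cast hN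
  have hN0 : (N : ℂ) ≠ 0 := by exact_mod_cast hn.ne'
  -- The constant test function makes the sum equal to N, which is then divided out; the density has
  -- total mass 1.
  obtain ⟨h1, h2⟩ := integral_eigenDensity_mul_sum hN (g := fun _ => 1) measurable_const (B := 1)
    (by simp)
  simp only [Finset.sum_const, Finset.card_univ, Fintype.card_fin, nsmul_eq_mul, mul_one] at h1 h2
  constructor
  · have := (h1.mul_const ((N : ℂ)⁻¹)).re
    refine this.congr (.of_forall fun l => ?_)
    simp only [mul_assoc, mul_inv_cancel₀ hN0, mul_one]
    simp
  · rw [integral_mul_const, integral_complex_ofReal, integral_complex_ofReal] at h2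
    have hm := expMoment_densityPoly hN
    rw [expMoment] at hm
    rw [hm, Complex.ofReal_one, mul_one] at h2
    exact_mod_cast mul_right_cancel₀ hN0 h2

theorem partitionFn_pos {N : ℕ} (hN : 1 ≤ N) : 0 < partitionFn 1 N := by
  have hn : (0 : ℝ) < N := by exact_mod_cast hN
  rw [(integral_eigenDensity hN).2]
  exact mul_pos (by positivity) (Finset.prod_pos fun i _ => laguerreNormSq_pos (inv_pos.mpr hn) i)

theorem integral_resolventIntegrand {N : ℕ} (hN : 1 ≤ N) {x : ℂ} (hx : x ∈ offCut) :
    IntegrableOn (resolventIntegrand 1 N x) (orthant N) ∧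
      oneLoopMean 1 N x = stieltjes N (densityPoly N) x := by
  obtain ⟨B, hB⟩ := exists_norm_one_div_sub_le hx
  -- With the resolvent kernel as test function, the prefactor N! ∏ h_k is the partition function
  -- and cancels in the mean.
  obtain ⟨h1, h2⟩ := integral_eigenDensity_mul_sum hN (g := fun t : ℝ => 1 / (x - t))
    (by fun_prop) hB
  refine ⟨h1, ?_⟩
  have hN0 : (N : ℂ) ≠ 0 := by exact_mod_cast (by omega : N ≠ 0)
  have hZ : (partitionFn 1 N : ℂ) ≠ 0 := by exact_mod_cast (partitionFn_pos hN).ne'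
  have h3 : ∫ l in orthant N, resolventIntegrand 1 N x l
      = partitionFn 1 N * (N * stieltjes N (densityPoly N) x) := by
    rw [(integral_eigenDensity hN).2]
    push_cast
    push_cast at h2
    unfold stieltjes
    push_cast
    exact h2
  rw [oneLoopMean, h3]
  field_simp

end LaguerreLoop

theorem mainTheorem6 (N : ℕ) (hN : 1 ≤ N) :
    (IntegrableOn (LaguerreLoop.eigenDensity 1 N) (LaguerreLoop.orthant N) ∧
      0 < LaguerreLoop.partitionFn 1 N) ∧
    (∀ x ∈ LaguerreLoop.offCut,
      IntegrableOn (LaguerreLoop.resolventIntegrand 1 N x) (LaguerreLoop.orthant N)) ∧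
    DifferentiableOn ℂ (LaguerreLoop.oneLoopMean 1 N) LaguerreLoop.offCut ∧
    ∀ x ∈ LaguerreLoop.offCut, ∀ W : ℕ → ℂ,
      (∀ n, W n = iteratedDeriv n (LaguerreLoop.oneLoopMean 1 N) x) →
      (N : ℂ) ^ 2 * ((-2 * x ^ 2 + 8 * x) * W 1 + 4 * W 0)
        + (N : ℂ) * ((-x ^ 2 + 8 * x) * W 1 + 4 * W 0)
        + (2 * x ^ 2 * W 3 + (-x ^ 2 + 12 * x) * W 2 + (-x + 12) * W 1 + W 0)
        + (N : ℂ)⁻¹ * (x ^ 2 * W 3 + 6 * x * W 2 + 6 * W 1)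
        + ((N : ℂ) ^ 2)⁻¹ * (x ^ 2 * W 4 + 7 * x * W 3 + 9 * W 2)
      = 2 * (N : ℂ) ^ 2 + (N : ℂ) + (2 * (N : ℂ) + 2) / x := by
  have hn : (0 : ℝ) < N := by exact_mod_cast hN
  have heq : Set.EqOn (LaguerreLoop.oneLoopMean 1 N)
      (LaguerreLoop.stieltjes N (LaguerreLoop.densityPoly N)) LaguerreLoop.offCut :=
    fun x hx => (LaguerreLoop.integral_resolventIntegrand hN hx).2
  refine ⟨⟨(LaguerreLoop.integral_eigenDensity hN).1, LaguerreLoop.partitionFn_pos hN⟩,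
    fun x hx => (LaguerreLoop.integral_resolventIntegrand hN hx).1, ?_, ?_⟩
  · refine DifferentiableOn.congr (fun x hx => ?_) heq
    exact (LaguerreLoop.hasDerivAt_stieltjes hn _ hx).differentiableAt.differentiableWithinAt
  · intro x hx W hW
    simp only [hW]
    exact LaguerreLoop.stieltjes_densityPoly_ode hN heq hx
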